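/- Let $\mathbb T$ be the tree in which every vertex is contained in countably infinitely many edges. A *covering forest* is a forest obtained from $\mathbb T$ by removing a finite set of edges. A *spheromorphism* is an isomorphism of one covering forest onto another, regarded as a permutation of $\mathrm{vert}(\mathbb T)$; the spheromorphisms form a group $\mathrm{Hier}(\mathbb T)$ under composition ($hg=h\circ g$). For a nonempty finite subtree $J\subset\mathbb T$ let $\mathcal K(J)\subset\mathrm{Aut}(\mathbb T)\subset \mathrm{Hier}(\mathbb T)$ be the pointwise stabilizer of $J$. Let $I,J\subset\mathbb T$ be nonempty finite subtrees. An *$(I,J)$-bi-tree* is a triple $(\Gamma,\iota,j)$, where $\Gamma$ is a finite graph without loops or multiple edges, each of whose edges is colored black, blue or red, and $\iota:I\to\Gamma$, $j:J\to\Gamma$ are graph embeddings (injective on vertices, sending edges to edges), such that * the subgraph $\Gamma^{\rm black}_{\rm blue}$ consisting of all vertices and all black and blue edges is a tree, and so is the subgraph $\Gamma^{\rm black}_{\rm red}$ consisting of all vertices and all black and red edges; * $\iota(I)\subset\Gamma^{\rm black}_{\rm blue}$ and $j(J)\subset\Gamma^{\rm black}_{\rm red}$; * every vertex of $\Gamma$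 of valence $1$ is an end of a black edge and is contained in $\iota(I)$ or $j(J)$. Two $(I,J)$-bi-trees $(\Gamma,\iota,j)$, $(\Gamma',\iota',j')$ are *equivalent* if there is a color-preserving isomorphism $\lambda:\Gamma\to\Gamma'$ with $\iota'=\lambda\circ\iota$, $j'=\lambda\circ j$. For $g\in\mathrm{Hier}(\mathbb T)$ define $\Gamma_{I,J}(g)$ as follows. Let $\{S_\alpha\}$ be the perfect covering forest of $g$: $g$ sends every edge of each $S_\alpha$ to an edge of $\mathbb T$, and every covering forest with this property is obtained from $\{S_\alpha\}$ by removing edges. Call the edges of $\mathbb T$ outside $\bigcup S_\alpha$ blue, and those outside $\bigcup gS_\alpha$ red. Let $\mathrm{Skel}_I$ be the minimal subtree of $\mathbb T$ containing $I$ and all blue edges, and $\mathrm{Skel}_J$ the minimal subtree containing $J$ and all red edges. Let $\Xi_\alpha$ be the minimal subtree of $S_\alpha$ containing $S_\alpha\cap\mathrm{Skel}_I$ and $g^{-1}(gS_\alpha\cap\mathrm{Skel}_J)$. The graph $\Gamma_{I,J}(g)$ is the disjoint union of the trees $\Xi_\alpha$, with edges painted black, together with the blue edges, and with a red edge joining $g^{-1}c$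 and $g^{-1}d$ for every red edge $[c,d]$ of $\mathbb T$; $\iota$ is the inclusion of $I$, and $j=g^{-1}|_J$. **Proposition 4.1.** For every $g\in \mathrm{Hier}(\mathbb T)$ the triple $\Gamma_{I,J}(g)$ is an $(I,J)$-bi-tree. The map $\mathcal K(J)\,g\,\mathcal K(I)\mapsto[\Gamma_{I,J}(g)]$ is a well-defined bijection from $\mathcal K(J)\backslash\mathrm{Hier}(\mathbb T)/\mathcal K(I)$ onto the set of equivalence classes of $(I,J)$-bi-trees; likewise $\mathcal K(I)\,g\,\mathcal K(J)\mapsto[\Gamma_{I,J}(g^{-1})]$ is a well-defined bijection from $\mathcal K(I)\backslash\mathrm{Hier}(\mathbb T)/\mathcal K(J)$ onto the same set. -/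

import Mathlib

universe u

namespace Sphero

/-- The tree `𝕋` (unique up to isomorphism): a tree in which every vertex is contained in a
countably infinite number of edges. -/
structure IsCountableValenceTree {V : Type u} (T : SimpleGraph V) : Prop where
  isTree : T.IsTree
  countable : ∀ v, (T.neighborSet v).Countable
  infinite : ∀ v, (T.neighborSet v).Infinite

/-- A covering forest of `T` is what is left of `T` after removing a finite set `E` of edges; it is
encoded by `E`, and its members are the connected components of `T.deleteEdges E`. -/
structure IsCoveringForest {V : Type u} (T : SimpleGraph V) (E : Set (Sym2 V)) : Prop where
  subset : E ⊆ T.edgeSet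
  finite : E.Finite

/-- A spheromorphism, regarded as a permutation of the vertices: an isomorphism of
one covering forest onto another one. -/
def IsSpheromorphism {V : Type u} (T : SimpleGraph V) (g : Equiv.Perm V) : Prop :=
  ∃ E F : Set (Sym2 V), IsCoveringForest T E ∧ IsCoveringForest T F ∧
    ∀ a b, (T.deleteEdges F).Adj (g a) (g b) ↔ (T.deleteEdges E).Adj a b

theorem IsSpheromorphism.mul {V : Type u} {T : SimpleGraph V} {h g : Equiv.Perm V}
    (hh : IsSpheromorphism T h) (hg : IsSpheromorphism T g) : IsSpheromorphism T (h * g) := by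
  obtain ⟨A, B, hA, hB, hAB⟩ := hh
  obtain ⟨C, D, hC, hD, hCD⟩ := hg
  simp only [SimpleGraph.deleteEdges_adj] at hAB hCD
  have key : ∀ (k : Equiv.Perm V) (X : Set (Sym2 V)), X.Finite →
      (Sym2.map k ⁻¹' X).Finite := fun k X hX =>
    hX.preimage (Sym2.map.injective k.injective).injOn
  refine ⟨T.edgeSet ∩ (C ∪ Sym2.map g ⁻¹' (A ∪ D)),
    T.edgeSet ∩ (B ∪ Sym2.map (h⁻¹ : Equiv.Perm V) ⁻¹' (A ∪ D)),
    ⟨Set.inter_subset_left, (hC.finite.union (key _ _ (hA.finite.union hD.finite))).subset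
      Set.inter_subset_right⟩,
    ⟨Set.inter_subset_left, (hB.finite.union (key _ _ (hA.finite.union hD.finite))).subset
      Set.inter_subset_right⟩, fun a b => ?_⟩
  have h1 := hAB (g a) (g b)
  have h2 := hCD a b
  simp only [SimpleGraph.deleteEdges_adj, Set.mem_inter_iff, Set.mem_union, Set.mem_preimage,
    SimpleGraph.mem_edgeSet, Sym2.map_mk, Equiv.Perm.mul_apply, Equiv.Perm.inv_def,
    Equiv.symm_apply_apply]
  tauto

theorem IsSpheromorphism.one {V : Type u} (T : SimpleGraph V) : IsSpheromorphism T 1 :=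
  ⟨∅, ∅, ⟨Set.empty_subset _, Set.finite_empty⟩, ⟨Set.empty_subset _, Set.finite_empty⟩,
    fun _ _ => Iff.rfl⟩

theorem IsSpheromorphism.inv {V : Type u} {T : SimpleGraph V} {g : Equiv.Perm V}
    (hg : IsSpheromorphism T g) : IsSpheromorphism T g⁻¹ := by
  obtain ⟨E, F, hE, hF, h⟩ := hg
  refine ⟨F, E, hF, hE, fun a b => ?_⟩
  rw [← h]
  simp

/-- The group `Hier(T)` of all spheromorphisms; the product `h * g` is `h ∘ g`. -/
def Hier {V : Type u} (T : SimpleGraph V) : Subgroup (Equiv.Perm V) where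
  carrier := {g | IsSpheromorphism T g}
  mul_mem' := fun hh hg => hh.mul hg
  one_mem' := IsSpheromorphism.one T
  inv_mem' := fun hg => hg.inv

/-- The group `𝒦(J)` of the automorphisms of `T` that fix every vertex of `J`,
as a subgroup of `Hier(T)`. -/
def stab {V : Type u} {T : SimpleGraph V} (J : T.Subgraph) : Subgroup (Hier T) where
  carrier := {g | (∀ a b, T.Adj (g.1 a) (g.1 b) ↔ T.Adj a b) ∧ ∀ v ∈ J.verts, g.1 v = v}
  mul_mem' := by
    rintro h g ⟨hh, hh'⟩ ⟨hg, hg'⟩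
    refine ⟨fun a b => ?_, fun v hv => ?_⟩
    · exact (hh _ _).trans (hg _ _)
    · change h.1 (g.1 v) = v
      rw [hg' v hv, hh' v hv]
  one_mem' := ⟨fun _ _ => Iff.rfl, fun _ _ => rfl⟩
  inv_mem' := by
    rintro g ⟨hg, hg'⟩
    refine ⟨fun a b => ?_, fun v hv => ?_⟩
    · rw [← hg]
      simp
    · change g.1⁻¹ v = v
      rw [Equiv.Perm.inv_eq_iff_eq]
      exact (hg' v hv).symm

/-- The covering forest obtained by removing `E` is compatible with `g`: the restriction of `g` to
each of its trees sends edges to edges, i.e. is an embedding of trees. -/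
structure IsCompatible {V : Type u} (T : SimpleGraph V) (g : Equiv.Perm V) (E : Set (Sym2 V)) :
    Prop extends IsCoveringForest T E where
  map_adj : ∀ a b, (T.deleteEdges E).Adj a b → T.Adj (g a) (g b)

/-- The perfect covering forest for `g`: it is compatible with `g`, and every compatible covering
forest is obtained from it by removing edges. -/
def IsPerfect {V : Type u} (T : SimpleGraph V) (g : Equiv.Perm V) (E : Set (Sym2 V)) : Prop :=
  IsCompatible T g E ∧ ∀ E', IsCompatible T g E' → E ⊆ E'

/-- The edges of `T` that `g` does not send to edges. By `isPerfect_iff` below, these are the edges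
to be removed from `T` to get the perfect covering forest for `g`. -/
def cutEdges {V : Type u} (T : SimpleGraph V) (g : Equiv.Perm V) : Set (Sym2 V) :=
  {e | e ∈ T.edgeSet ∧ e.map g ∉ T.edgeSet}

theorem isPerfect_iff {V : Type u} {T : SimpleGraph V} {g : Equiv.Perm V}
    (hg : IsSpheromorphism T g) (E : Set (Sym2 V)) : IsPerfect T g E ↔ E = cutEdges T g := by
  have hmin : ∀ E', IsCompatible T g E' → cutEdges T g ⊆ E' := by
    intro E' hE' e
    induction e with
    | _ a b =>
      rintro ⟨h1, h2⟩
      by_contra h3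
      exact h2 (hE'.map_adj a b (by simpa [SimpleGraph.deleteEdges_adj] using ⟨h1, h3⟩))
  have hcomp : IsCompatible T g (cutEdges T g) := by
    obtain ⟨A, B, hA, hB, hAB⟩ := hg
    have hA' : IsCompatible T g A :=
      { hA with map_adj := fun a b hab => ((T.deleteEdges_le B) ((hAB a b).2 hab)) }
    refine { subset := fun e he => he.1, finite := hA.finite.subset (hmin A hA'), map_adj := ?_ }
    intro a b hab
    rw [SimpleGraph.deleteEdges_adj] at hab
    by_contra h
    exact hab.2 ⟨hab.1, h⟩
  constructor
  · rintro ⟨h1, h2⟩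
    exact Set.Subset.antisymm (h2 _ hcomp) (hmin _ h1)
  · rintro rfl
    exact ⟨hcomp, hmin⟩

/-- The edges of `T` that do not belong to the images under `g` of the trees of the perfect covering
forest for `g`. -/
def imageCutEdges {V : Type u} (T : SimpleGraph V) (g : Equiv.Perm V) : Set (Sym2 V) :=
  T.edgeSet \ (Sym2.map g '' (T.edgeSet \ cutEdges T g))

/-- The vertices that are ends of edges in `E`. -/
def ends {V : Type u} (E : Set (Sym2 V)) : Set V := {v | ∃ e ∈ E, v ∈ e}

/-- The vertex set of the minimal subtree of the tree `T` containing the set `A` of vertices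
(subtrees of a tree are induced subgraphs, so they are determined by their vertices). -/
def hull {V : Type u} (T : SimpleGraph V) (A : Set V) : Set V :=
  ⋂₀ {S | A ⊆ S ∧ (T.induce S).Preconnected}

theorem subset_hull {V : Type u} (T : SimpleGraph V) (A : Set V) : A ⊆ hull T A :=
  Set.subset_sInter fun _ hS => hS.1

/-- The vertices of the `I`-skeleton of the perfect covering forest `{S_α}` of `g`: the minimal
subtree of `T` containing `I` and all removed (blue) edges. -/
def sourceSkeleton {V : Type u} {T : SimpleGraph V} (I : T.Subgraph) (g : Equiv.Perm V) : Set V :=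
  hull T (I.verts ∪ ends (cutEdges T g))

/-- The vertices of the `J`-skeleton of the image forest `{g S_α}`: the minimal subtree of `T`
containing `J` and all edges outside the image forest (red edges). -/
def targetSkeleton {V : Type u} {T : SimpleGraph V} (J : T.Subgraph) (g : Equiv.Perm V) : Set V :=
  hull T (J.verts ∪ ends (imageCutEdges T g))

/-- The vertices of the union of the trees `Ξ_α`. Here `Ξ_α` is the minimal subtree containing the
parts of the `I`-skeleton and of the `g`-preimage of the `J`-skeleton that lie in the tree `S_α`
of the perfect covering forest. -/
def blackVerts {V : Type u} {T : SimpleGraph V} (I J : T.Subgraph) (g : Equiv.Perm V) : Set V :=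
  ⋃ S : (T.deleteEdges (cutEdges T g)).ConnectedComponent,
    hull T (S.supp ∩ (sourceSkeleton I g ∪ g ⁻¹' targetSkeleton J g))

theorem mem_blackVerts {V : Type u} {T : SimpleGraph V} (I J : T.Subgraph) (g : Equiv.Perm V)
    {v : V} (hv : v ∈ sourceSkeleton I g ∪ g ⁻¹' targetSkeleton J g) : v ∈ blackVerts I J g :=
  Set.mem_iUnion.2 ⟨(T.deleteEdges (cutEdges T g)).connectedComponentMk v,
    subset_hull _ _ ⟨SimpleGraph.ConnectedComponent.mem_supp_iff _ _ |>.2 rfl, hv⟩⟩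

/-- A graph without loops and multiple edges, whose edges are coloured black, blue and red (each
edge has one colour), together with maps of the vertex sets of `I` and `J` to it. -/
structure MarkedGraph {V : Type u} {T : SimpleGraph V} (I J : T.Subgraph) where
  vert : Type u
  black : SimpleGraph vert
  blue : SimpleGraph vert
  red : SimpleGraph vert
  black_blue : Disjoint black blue
  black_red : Disjoint black red
  blue_red : Disjoint blue red
  ι : I.verts → vert
  j : J.verts → vert

/-- `(Γ, ι, j)` is an `(I, J)`-bi-tree. -/
structure MarkedGraph.IsBiTree {V : Type u} {T : SimpleGraph V} {I J : T.Subgraph}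
    (Γ : MarkedGraph I J) : Prop where
  finite : Finite Γ.vert
  black_blue_isTree : (Γ.black ⊔ Γ.blue).IsTree
  black_red_isTree : (Γ.black ⊔ Γ.red).IsTree
  ι_injective : Function.Injective Γ.ι
  ι_adj : ∀ a b, I.coe.Adj a b → (Γ.black ⊔ Γ.blue).Adj (Γ.ι a) (Γ.ι b)
  j_injective : Function.Injective Γ.j
  j_adj : ∀ a b, J.coe.Adj a b → (Γ.black ⊔ Γ.red).Adj (Γ.j a) (Γ.j b)
  valence_one : ∀ v, ((Γ.black ⊔ Γ.blue ⊔ Γ.red).neighborSet v).ncard = 1 →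
    (∃ w, Γ.black.Adj v w) ∧ (v ∈ Set.range Γ.ι ∨ v ∈ Set.range Γ.j)

/-- Equivalence: there is a colour-preserving isomorphism `e` with `ι' = e ∘ ι`, `j' = e ∘ j`. -/
def MarkedGraph.Equivalent {V : Type u} {T : SimpleGraph V} {I J : T.Subgraph}
    (Γ Γ' : MarkedGraph I J) : Prop :=
  ∃ e : Γ.vert ≃ Γ'.vert,
    (∀ a b, Γ'.black.Adj (e a) (e b) ↔ Γ.black.Adj a b) ∧
    (∀ a b, Γ'.blue.Adj (e a) (e b) ↔ Γ.blue.Adj a b) ∧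
    (∀ a b, Γ'.red.Adj (e a) (e b) ↔ Γ.red.Adj a b) ∧
    (∀ a, Γ'.ι a = e (Γ.ι a)) ∧ (∀ a, Γ'.j a = e (Γ.j a))

/-- The type of all `(I, J)`-bi-trees. -/
def BiTree {V : Type u} {T : SimpleGraph V} (I J : T.Subgraph) : Type (u + 1) :=
  {Γ : MarkedGraph I J // Γ.IsBiTree}

instance biTreeSetoid {V : Type u} {T : SimpleGraph V} (I J : T.Subgraph) :
    Setoid (BiTree I J) where
  r Γ Γ' := Γ.1.Equivalent Γ'.1
  iseqv :=
    { refl := fun _ => ⟨Equiv.refl _, fun _ _ => Iff.rfl, fun _ _ => Iff.rfl, fun _ _ => Iff.rfl,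
        fun _ => rfl, fun _ => rfl⟩
      symm := by
        rintro _ _ ⟨e, h1, h2, h3, h4, h5⟩
        refine ⟨e.symm, fun a b => ?_, fun a b => ?_, fun a b => ?_, fun a => ?_, fun a => ?_⟩
        · rw [← h1]; simp
        · rw [← h2]; simp
        · rw [← h3]; simp
        · rw [h4]; simp
        · rw [h5]; simp
      trans := by
        rintro _ _ _ ⟨e, h1, h2, h3, h4, h5⟩ ⟨f, k1, k2, k3, k4, k5⟩
        exact ⟨e.trans f, fun a b => (k1 _ _).trans (h1 _ _), fun a b => (k2 _ _).trans (h2 _ _),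
          fun a b => (k3 _ _).trans (h3 _ _), fun a => (k4 a).trans (congrArg f (h4 a)),
          fun a => (k5 a).trans (congrArg f (h5 a))⟩ }

/-- The set of `(I, J)`-bi-trees up to equivalence. -/
abbrev BiTreeClass {V : Type u} {T : SimpleGraph V} (I J : T.Subgraph) : Type (u + 1) :=
  Quotient (biTreeSetoid I J)

/-- The bi-tree of a spheromorphism `g`, with `I` in the source and `J` in the target of `g`. The
black edges are the edges of the trees `Ξ_α`; the blue edges are the edges of `T` outside the
perfect covering forest `{S_α}`; two vertices are joined by a red edge if their images under `g`
are joined by an edge of `T` outside `{g S_α}`. The map of `I` is the inclusion, the map of `J` is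
the restriction of the inverse of `g`. -/
def biTreeOf {V : Type u} {T : SimpleGraph V} (I J : T.Subgraph) (g : Equiv.Perm V) :
    MarkedGraph I J where
  vert := blackVerts I J g
  black := (T.deleteEdges (cutEdges T g)).induce (blackVerts I J g)
  blue := (SimpleGraph.fromEdgeSet (cutEdges T g)).induce (blackVerts I J g)
  red := ((SimpleGraph.fromEdgeSet (imageCutEdges T g)).comap g).induce (blackVerts I J g)
  black_blue := by
    rw [SimpleGraph.disjoint_left]
    intro a b h h'
    simp only [SimpleGraph.comap_adj, SimpleGraph.deleteEdges_adj,
      SimpleGraph.fromEdgeSet_adj] at h h'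
    exact h.2 h'.1
  black_red := by
    rw [SimpleGraph.disjoint_left]
    intro a b h h'
    simp only [SimpleGraph.comap_adj, SimpleGraph.deleteEdges_adj,
      SimpleGraph.fromEdgeSet_adj] at h h'
    exact h'.1.2 ⟨s(a.1, b.1), h, rfl⟩
  blue_red := by
    rw [SimpleGraph.disjoint_left]
    intro a b h h'
    simp only [SimpleGraph.comap_adj, SimpleGraph.fromEdgeSet_adj] at h h'
    exact h.1.2 h'.1.1
  ι := fun v => ⟨v.1, mem_blackVerts I J g (Or.inl (subset_hull _ _ (Or.inl v.2)))⟩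
  j := fun w => ⟨g⁻¹ w.1, mem_blackVerts I J g (Or.inr (by
    rw [Set.mem_preimage, Equiv.Perm.inv_def, Equiv.apply_symm_apply]
    exact subset_hull _ _ (Or.inl w.2)))⟩

end Sphero

namespace Sphero

open SimpleGraph


/-! ### Convex sets in forests -/

section Convexity

variable {X : Type*} {Y : Type*} {G H : SimpleGraph X} {S S' A : Set X}

/-! A spheromorphism `g` puts two tree structures on the same vertex set: `B = T` and `R = T.comap
g`. Black edges lie in both, blue ones only in `B`, red ones only in `R`, and only finitely many
edges are blue or red. The bi-tree is then the restriction of the pair `(B, R)` to a finite set,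
`core B R I (g⁻¹ J)` (`blackVerts_eq_core`), a description symmetric in the two trees.

The core is connected in both trees (`preconnected_core`), and minimality forces its vertices of
valence one to be marked (`mem_of_unique_adj`); hence it is a bi-tree. Conversely, a finite set
convex in both trees that contains the marked vertices and the ends of all blue and red edges is the
core as soon as its vertices of valence one are marked (`core_eq_of_forall_unique_adj`).

The other ingredient is back-and-forth: a bijection between finite subtrees extends to a permutation
of the vertices that respects adjacency except possibly inside the subtrees, since a new vertex
hangs on a subtree by at most one edge and infinite valence always leaves a free place for it
(`IsPartialIso.exists_equiv`).

For injectivity, an equivalence of bi-trees extends to an automorphism `k` of `T` that also carries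
`R` for `g` to `R` for `h`, so `h * k * g⁻¹` is an automorphism too. For surjectivity, the
black-blue and black-red trees are embedded in `T` extending the inclusions of `I` and `J`, and the
bijection between their images is extended to `g`. Inversion of `g` gives the second bijection. -/

theorem mem_support_map {K : SimpleGraph Y} {f : G →g K} {a b x : X} {p : G.Walk a b}
    (hx : x ∈ p.support) : f x ∈ (p.map f).support := by
  rw [Walk.support_map]
  exact List.mem_map_of_mem hx

theorem exists_mem_support_of_mem_support_map {K : SimpleGraph Y} {f : G →g K} {a b : X}
    {p : G.Walk a b} {y : Y} (hy : y ∈ (p.map f).support) : ∃ x, x ∈ p.support ∧ f x = y := by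
  rw [Walk.support_map] at hy
  exact List.mem_map.1 hy

/-- A set of vertices is convex if it contains every path between two of its points. -/
def IsConvex (G : SimpleGraph X) (S : Set X) : Prop :=
  ∀ ⦃a⦄, a ∈ S → ∀ ⦃b⦄, b ∈ S → ∀ p : G.Walk a b, p.IsPath → ∀ x ∈ p.support, x ∈ S

/-- The convex closure of a set of vertices. -/
def closure (G : SimpleGraph X) (A : Set X) : Set X := ⋂₀ {S | A ⊆ S ∧ IsConvex G S}

theorem IsConvex.mono (h : IsConvex G S) (hHG : H ≤ G) : IsConvex H S := by
  intro a ha b hb p hp x hx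
  exact h ha hb (p.mapLe hHG) (hp.mapLe hHG) x (by simpa using hx)

theorem isConvex_closure : IsConvex G (closure G A) := by
  intro a ha b hb p hp x hx S hS
  exact hS.2 (ha S hS) (hb S hS) p hp x hx

theorem subset_closure : A ⊆ closure G A := fun _ ha _ hS => hS.1 ha

theorem closure_subset (h : A ⊆ S) (hS : IsConvex G S) : closure G A ⊆ S :=
  fun _ hx => hx S ⟨h, hS⟩

/-- In a forest, the path inside `S` between two of its points is the only path between them. -/
theorem isConvex_of_preconnected (hG : G.IsAcyclic) (hS : (G.induce S).Preconnected) :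
    IsConvex G S := by
  classical
  intro a ha b hb p hp x hx
  obtain ⟨q, hq⟩ := (hS ⟨a, ha⟩ ⟨b, hb⟩).exists_isPath
  have hq' : (q.map (Embedding.induce S).toHom).IsPath :=
    hq.map Subtype.val_injective
  have := congrArg Subtype.val ((hG.subsingleton_path a b).elim ⟨p, hp⟩ ⟨_, hq'⟩)
  simp only at this
  rw [this] at hx
  obtain ⟨y, -, rfl⟩ := exists_mem_support_of_mem_support_map hx
  exact y.2

theorem IsConvex.reachable (hS : IsConvex G S) {a b : X} (ha : a ∈ S) (hb : b ∈ S)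
    (h : G.Reachable a b) : (G.induce S).Reachable ⟨a, ha⟩ ⟨b, hb⟩ := by
  obtain ⟨p, hp⟩ := h.exists_isPath
  exact ⟨p.induce S (hS ha hb p hp)⟩

theorem IsConvex.preconnected (hS : IsConvex G S) (hG : G.Preconnected) :
    (G.induce S).Preconnected := fun a b => hS.reachable a.2 b.2 (hG a b)

theorem closure_eq_hull (hG : G.IsTree) (A : Set X) : closure G A = hull G A := by
  unfold closure hull
  congr 1
  ext S
  exact and_congr_right fun _ => ⟨fun h => h.preconnected hG.connected.preconnected,
    isConvex_of_preconnected hG.isAcyclic⟩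

theorem finite_closure (hG : G.IsTree) (hA : A.Finite) : (closure G A).Finite := by
  classical
  obtain ⟨u⟩ := hG.connected.nonempty
  obtain ⟨t, ht, ht'⟩ := extend_finset_to_connected hG.connected.preconnected
    (t := insert u hA.toFinset) (by simp)
  refine t.finite_toSet.subset (closure_subset (fun a ha => ?_)
    (isConvex_of_preconnected hG.isAcyclic ht'.preconnected))
  exact ht (by simp [ha])

/-- An interior vertex of a path has two neighbours on it. -/
theorem exists_two_adj_of_mem_support {a b x : X} (p : G.Walk a b) (hp : p.IsPath)
    (hx : x ∈ p.support) (ha : x ≠ a) (hb : x ≠ b) :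
    ∃ y ∈ p.support, ∃ z ∈ p.support, y ≠ z ∧ G.Adj x y ∧ G.Adj x z := by
  induction p with
  | nil => simp at hx; exact absurd hx ha
  | @cons a c b h q ih =>
    rw [Walk.cons_isPath_iff] at hp
    rw [Walk.support_cons, List.mem_cons] at hx
    have hx := hx.resolve_left ha
    by_cases hc : x = c
    · subst hc
      cases q with
      | nil => exact absurd rfl hb
      | @cons _ d _ h' q' =>
        have hd : d ∈ (Walk.cons h' q').support := by simp
        exact ⟨a, by simp, d, by simp, fun e => hp.2 (e ▸ hd), h.symm, h'⟩
    · obtain ⟨y, hy, z, hz, h1⟩ := ih hp.1 hx hc hb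
      exact ⟨y, by simp [hy], z, by simp [hz], h1⟩

/-- Pruning a leaf: a path through `v` with ends elsewhere would use two neighbours of `v`, both in
`S` by convexity. -/
theorem IsConvex.diff_singleton (hS : IsConvex G S) {v : X}
    (h : ∀ y ∈ S, ∀ z ∈ S, G.Adj v y → G.Adj v z → y = z) : IsConvex G (S \ {v}) := by
  intro a ha b hb p hp x hx
  refine ⟨hS ha.1 hb.1 p hp x hx, ?_⟩
  rintro rfl
  obtain ⟨y, hy, z, hz, hne, h1, h2⟩ := exists_two_adj_of_mem_support p hp hx
    (fun e => ha.2 e.symm) (fun e => hb.2 e.symm)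
  exact hne (h y (hS ha.1 hb.1 p hp y hy) z (hS ha.1 hb.1 p hp z hz) h1 h2)

/-- A vertex outside a convex set of a forest has at most one neighbour in it. -/
theorem IsConvex.eq_of_adj (hS : IsConvex G S) {v y z : X} (hv : v ∉ S) (hy : y ∈ S) (hz : z ∈ S)
    (h1 : G.Adj v y) (h2 : G.Adj v z) : y = z := by
  by_contra hne
  refine hv (hS hy hz (Walk.cons h1.symm (Walk.cons h2 Walk.nil)) ?_ v (by simp))
  simp [Walk.cons_isPath_iff, h1.ne', h2.ne, hne]

theorem IsConvex.comap_equiv (e : X ≃ Y) {G : SimpleGraph Y} {S : Set Y} :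
    IsConvex (G.comap e) (e ⁻¹' S) ↔ IsConvex G S := by
  let i : G.comap e ≃g G := Iso.comap e G
  constructor
  · intro h a ha b hb p hp x hx
    have h1 : ((p.map i.symm.toHom)).IsPath := hp.map i.symm.injective
    have := h (a := i.symm a) (by change e (e.symm a) ∈ S; simpa using ha)
      (b := i.symm b) (by change e (e.symm b) ∈ S; simpa using hb) _ h1 (i.symm x)
      (mem_support_map hx)
    change e (e.symm x) ∈ S at this
    simpa using this
  · intro h a ha b hb p hp x hx
    exact h ha hb (p.map i.toHom) (hp.map i.injective) (e x)
      (mem_support_map hx)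

theorem closure_comap_equiv (e : X ≃ Y) (G : SimpleGraph Y) (A : Set Y) :
    closure (G.comap e) (e ⁻¹' A) = e ⁻¹' closure G A := by
  apply Set.Subset.antisymm
  · exact closure_subset (Set.preimage_mono subset_closure)
      ((IsConvex.comap_equiv e).2 isConvex_closure)
  · intro x hx S hS
    have := hx (e.symm ⁻¹' S) ⟨fun y hy => hS.1 (by simpa using hy), ?_⟩
    · simpa using this
    · rw [← IsConvex.comap_equiv e, ← Set.preimage_comp]
      simpa using hS.2

/-- An injective homomorphism from a connected graph to a forest reflects adjacency. -/
theorem adj_of_adj_map (hG : G.Preconnected) {K : SimpleGraph Y} (hK : K.IsAcyclic) (f : G →g K)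
    (hf : Function.Injective f) {a b : X} (h : K.Adj (f a) (f b)) : G.Adj a b := by
  obtain ⟨p, hp⟩ := (hG a b).exists_isPath
  have := congrArg Subtype.val
    ((hK.subsingleton_path _ _).elim ⟨p.map f, hp.map hf⟩ (Path.singleton h))
  simp only at this
  have hl := congrArg Walk.length this
  simp at hl
  exact Walk.adj_of_length_eq_one hl

theorem countable_of_isCountableValenceTree {T : SimpleGraph X} (hT : IsCountableValenceTree T) :
    Countable X := by
  obtain ⟨u⟩ := hT.isTree.connected.nonempty
  have key : ∀ n : ℕ, {v | ∃ p : T.Walk u v, p.length = n}.Countable := by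
    intro n
    induction n with
    | zero =>
      refine (Set.countable_singleton u).mono ?_
      rintro v ⟨p, hp⟩
      exact (Walk.eq_of_length_eq_zero hp).symm
    | succ n ih =>
      refine (ih.biUnion fun v _ => hT.countable v).mono ?_
      rintro v ⟨p, hp⟩
      have hnil : ¬ p.Nil := by
        intro h; rw [← Walk.length_eq_zero_iff] at h; omega
      simp only [Set.mem_iUnion]
      exact ⟨p.penultimate, ⟨p.dropLast, by simp [hp]⟩, p.adj_penultimate hnil⟩
  rw [← Set.countable_univ_iff]
  refine (Set.countable_iUnion key).mono fun v _ => ?_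
  obtain ⟨p⟩ := hT.isTree.connected u v
  exact Set.mem_iUnion.2 ⟨p.length, p, rfl⟩

end Convexity


/-! ### The core of a pair of graphs on one vertex set -/

section Core

variable {X : Type*} {Y : Type*} {B R : SimpleGraph X} {I J W : Set X}

/-- The ends of the edges of `B` that are not edges of `R`. -/
def diffEnds (B R : SimpleGraph X) : Set X := {v | ∃ w, B.Adj v w ∧ ¬ R.Adj v w}

/-- The vertices of the bi-tree of two graphs on the same set of vertices, with marked sets `I`
and `J`. -/
def core (B R : SimpleGraph X) (I J : Set X) : Set X :=
  closure (B ⊓ R) (closure B (I ∪ diffEnds B R) ∪ closure R (J ∪ diffEnds R B))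

theorem core_comm (B R : SimpleGraph X) (I J : Set X) : core B R I J = core R B J I := by
  unfold core
  rw [inf_comm, Set.union_comm]

theorem closure_subset_core : closure B (I ∪ diffEnds B R) ⊆ core B R I J :=
  Set.subset_union_left.trans subset_closure

theorem left_subset_core : I ⊆ core B R I J :=
  (Set.subset_union_left.trans subset_closure).trans closure_subset_core

theorem diffEnds_subset_core : diffEnds B R ⊆ core B R I J :=
  (Set.subset_union_right.trans subset_closure).trans closure_subset_core

theorem right_subset_core : J ⊆ core B R I J := by
  rw [core_comm]
  exact left_subset_core

theorem diffEnds_subset_core' : diffEnds R B ⊆ core B R I J := by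
  rw [core_comm]
  exact diffEnds_subset_core

theorem core_subset (hWB : IsConvex B W) (hWR : IsConvex R W) (hI : I ⊆ W) (hJ : J ⊆ W)
    (hB : diffEnds B R ⊆ W) (hR : diffEnds R B ⊆ W) : core B R I J ⊆ W :=
  closure_subset (Set.union_subset (closure_subset (Set.union_subset hI hB) hWB)
    (closure_subset (Set.union_subset hJ hR) hWR)) (hWB.mono inf_le_left)

theorem finite_core (hB : B.IsTree) (hR : R.IsTree) (hI : I.Finite) (hJ : J.Finite)
    (hBR : (diffEnds B R).Finite) (hRB : (diffEnds R B).Finite) : (core B R I J).Finite := by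
  refine (finite_closure hB ((finite_closure hB (hI.union hBR)).union
    (finite_closure hR (hJ.union hRB)))).subset ?_
  exact closure_subset subset_closure (isConvex_closure.mono inf_le_left)

/-- Follow the walk up to its first edge missing from `R`. That edge starts at a point of `diffEnds
B R`; if there is none, the walk ends in `I`. -/
theorem exists_reachable_inf {i : X} (hi : i ∈ I) {u : X} (p : B.Walk u i) :
    ∃ k ∈ closure B (I ∪ diffEnds B R), (B ⊓ R).Reachable u k := by
  induction p with
  | nil => exact ⟨_, subset_closure (Or.inl hi), Reachable.refl _⟩
  | @cons a c b h q ih =>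
    by_cases hR : R.Adj a c
    · obtain ⟨k, hk, hck⟩ := ih hi
      exact ⟨k, hk, (Adj.reachable (G := B ⊓ R) ⟨h, hR⟩).trans hck⟩
    · exact ⟨a, subset_closure (Or.inr ⟨c, h, hR⟩), Reachable.refl _⟩

/-- Inside the core, each vertex reaches the `B`-skeleton along common edges, and the skeleton is
itself connected in `B`. The `R` version follows from `core_comm`. -/
theorem preconnected_core (hB : B.Connected) (hI : I.Nonempty) :
    (B.induce (core B R I J)).Preconnected := by
  obtain ⟨i, hi⟩ := hI
  have key : ∀ u : core B R I J,
      (B.induce (core B R I J)).Reachable u ⟨i, left_subset_core hi⟩ := by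
    rintro ⟨u, hu⟩
    obtain ⟨p⟩ := hB u i
    obtain ⟨k, hk, huk⟩ := exists_reachable_inf (R := R) hi p
    have h1 : ((B ⊓ R).induce (core B R I J)).Reachable ⟨u, hu⟩ ⟨k, closure_subset_core hk⟩ :=
      isConvex_closure.reachable hu (closure_subset_core hk) huk
    have h2 : (B.induce (closure B (I ∪ diffEnds B R))).Reachable ⟨k, hk⟩
        ⟨i, subset_closure (Or.inl hi)⟩ :=
      isConvex_closure.reachable hk (subset_closure (Or.inl hi)) (hB k i)
    exact (h1.mono (comap_monotone _ inf_le_left)).trans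
      (h2.map (SimpleGraph.induceHomOfLE B closure_subset_core).toHom)
  exact fun u v => (key u).trans (key v).symm

theorem isConvex_core (hB : B.IsTree) (hI : I.Nonempty) : IsConvex B (core B R I J) :=
  isConvex_of_preconnected hB.isAcyclic (preconnected_core hB.connected hI)

/-- An unmarked leaf could be pruned from both skeletons and then from the core itself, against the
minimality of each closure. -/
theorem mem_of_unique_adj {v : X} (hv : v ∈ core B R I J) (hvB : v ∉ diffEnds B R)
    (hvR : v ∉ diffEnds R B)
    (hu : ∀ y ∈ core B R I J, ∀ z ∈ core B R I J, B.Adj v y → B.Adj v z → y = z) :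
    v ∈ I ∨ v ∈ J := by
  by_contra hIJ
  push Not at hIJ
  have hadj : ∀ y, R.Adj v y → B.Adj v y := fun y hy => by
    by_contra h
    exact hvR ⟨y, hy, h⟩
  have h1 : closure B (I ∪ diffEnds B R) ⊆ closure B (I ∪ diffEnds B R) \ {v} := by
    refine closure_subset ?_ (isConvex_closure.diff_singleton fun y hy z hz h h' =>
      hu y (closure_subset_core hy) z (closure_subset_core hz) h h')
    refine fun x hx => ⟨subset_closure hx, ?_⟩
    rintro rfl
    exact hx.elim hIJ.1 hvB
  have hsub : closure R (J ∪ diffEnds R B) ⊆ core B R I J := by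
    rw [core_comm]
    exact closure_subset_core
  have h2 : closure R (J ∪ diffEnds R B) ⊆ closure R (J ∪ diffEnds R B) \ {v} := by
    refine closure_subset ?_ (isConvex_closure.diff_singleton fun y hy z hz h h' =>
      hu y (hsub hy) z (hsub hz) (hadj y h) (hadj z h'))
    refine fun x hx => ⟨subset_closure hx, ?_⟩
    rintro rfl
    exact hx.elim hIJ.2 hvR
  have h3 : core B R I J ⊆ core B R I J \ {v} := by
    refine closure_subset ?_ (isConvex_closure.diff_singleton fun y hy z hz h h' =>
      hu y hy z hz h.1 h'.1)
    rintro x (hx | hx)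
    · exact ⟨closure_subset_core hx, (h1 hx).2⟩
    · exact ⟨hsub hx, (h2 hx).2⟩
  exact (h3 hv).2 rfl

/-- A vertex `y` of `W` outside the core and farthest from some `i ∈ I` is a leaf of `W`: a
neighbour beyond `y` is either in the core, which would put `y` there by convexity, or still farther
away. Since `B` and `R` agree at `y`, it has valence one in their union as well, so it is marked and
lies in the core after all. -/
theorem core_eq_of_forall_unique_adj (hB : B.IsTree) (hW : W.Finite)
    (hWB : IsConvex B W) (hWR : IsConvex R W) (hIne : I.Nonempty)
    (hI : I ⊆ W) (hJ : J ⊆ W) (hBW : diffEnds B R ⊆ W) (hRW : diffEnds R B ⊆ W)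
    (huniq : ∀ v ∈ W, ∀ w ∈ W, B.Adj v w → R.Adj v w →
      (∀ z ∈ W, B.Adj v z ∨ R.Adj v z → z = w) → v ∈ I ∨ v ∈ J) :
    core B R I J = W := by
  refine Set.Subset.antisymm (core_subset hWB hWR hI hJ hBW hRW) ?_
  by_contra hne
  obtain ⟨i, hi⟩ := hIne
  have hUconv : IsConvex B (core B R I J) := isConvex_core hB ⟨i, hi⟩
  have hiU : i ∈ core B R I J := left_subset_core hi
  obtain ⟨y, ⟨hyW, hyU⟩, hmax⟩ := Set.exists_max_image (W \ core B R I J) (B.dist i)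
    (hW.subset Set.sdiff_subset) (Set.not_subset.1 hne)
  obtain ⟨p, hp, hpl⟩ := hB.connected.exists_path_of_dist i y
  have hnil : ¬ p.Nil := fun h => hyU (h.eq ▸ hiU)
  have hyB : ∀ z, B.Adj y z → R.Adj y z := fun z hz => by
    by_contra h
    exact hyU (diffEnds_subset_core ⟨z, hz, h⟩)
  have hyR : ∀ z, R.Adj y z → B.Adj y z := fun z hz => by
    by_contra h
    exact hyU (diffEnds_subset_core' ⟨z, hz, h⟩)
  have hzp : ∀ z ∈ W, B.Adj y z → z = p.penultimate := by
    intro z hz hyz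
    by_cases hzs : z ∈ p.support
    · exact hB.isAcyclic.eq_penultimate_of_adj_end hp hyz hzs
    · exfalso
      have hq := hp.concat hzs hyz
      by_cases hzU : z ∈ core B R I J
      · exact hyU (hUconv hiU hzU _ hq y (by simp [Walk.support_concat]))
      · have h1 := hmax z ⟨hz, hzU⟩
        obtain ⟨q, hq', hql⟩ := hB.connected.exists_path_of_dist i z
        have h2 := congrArg (fun r : B.Path i z => r.1.length)
          ((hB.isAcyclic.subsingleton_path i z).elim ⟨_, hq⟩ ⟨q, hq'⟩)
        simp only [Walk.length_concat] at h2
        omega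
  have hpen := p.adj_penultimate hnil
  have hpenW : p.penultimate ∈ W := hWB (hI hi) hyW p hp _ (by simp)
  have := huniq y hyW _ hpenW hpen.symm (hyB _ hpen.symm)
    (fun z hz h => hzp z hz (h.elim id (hyR z)))
  exact hyU (this.elim (fun h => left_subset_core h) (fun h => right_subset_core h))

theorem diffEnds_comap (e : X ≃ Y) (B R : SimpleGraph Y) :
    diffEnds (B.comap e) (R.comap e) = e ⁻¹' diffEnds B R := by
  ext v
  constructor
  · rintro ⟨w, h⟩
    exact ⟨e w, h⟩
  · rintro ⟨w, h⟩
    exact ⟨e.symm w, by simpa using h⟩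

theorem core_comap (e : X ≃ Y) (B R : SimpleGraph Y) (I J : Set Y) :
    core (B.comap e) (R.comap e) (e ⁻¹' I) (e ⁻¹' J) = e ⁻¹' core B R I J := by
  unfold core
  rw [diffEnds_comap, diffEnds_comap, ← Set.preimage_union, ← Set.preimage_union,
    closure_comap_equiv, closure_comap_equiv, ← Set.preimage_union, ← closure_comap_equiv]
  rfl

end Core


/-! ### Extending partial isomorphisms of trees by back-and-forth -/

section Extension

variable {X : Type*} {Y : Type*}

/-- The relation `r` is the graph of a bijection between finite subtrees of `G` and `H` that extends
`r₀` and respects adjacency, except possibly between points in the domain of `r₀`. -/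
structure IsPartialIso (G : SimpleGraph X) (H : SimpleGraph Y) (r₀ r : Set (X × Y)) : Prop where
  subset : r₀ ⊆ r
  finite : r.Finite
  fst_eq_iff : ∀ p ∈ r, ∀ q ∈ r, p.1 = q.1 ↔ p.2 = q.2
  adj_iff : ∀ p ∈ r, ∀ q ∈ r, (p ∈ r₀ ∧ q ∈ r₀) ∨ (G.Adj p.1 q.1 ↔ H.Adj p.2 q.2)
  connected_fst : (G.induce (Prod.fst '' r)).Connected
  connected_snd : (H.induce (Prod.snd '' r)).Connected

variable {G : SimpleGraph X} {H : SimpleGraph Y} {r₀ r : Set (X × Y)}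

theorem IsPartialIso.swap (h : IsPartialIso G H r₀ r) :
    IsPartialIso H G (Prod.swap ⁻¹' r₀) (Prod.swap ⁻¹' r) where
  subset := Set.preimage_mono h.subset
  finite := h.finite.preimage Prod.swap_injective.injOn
  fst_eq_iff p hp q hq := (h.fst_eq_iff _ hp _ hq).symm
  adj_iff p hp q hq := (h.adj_iff _ hp _ hq).imp id Iff.symm
  connected_fst := by
    have : Prod.fst '' (Prod.swap ⁻¹' r) = Prod.snd '' r := by
      ext; simp
    rw [this]
    exact h.connected_snd
  connected_snd := by
    have : Prod.snd '' (Prod.swap ⁻¹' r) = Prod.fst '' r := by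
      ext; simp
    rw [this]
    exact h.connected_fst

theorem connected_induce_insert {S : Set X} {v w : X} (hS : (G.induce S).Connected) (hw : w ∈ S)
    (h : G.Adj w v) : (G.induce (insert v S)).Connected := by
  rw [← Set.union_singleton]
  have : (G.induce {v}).Connected := by
    have : Nonempty ({v} : Set X) := ⟨⟨v, rfl⟩⟩
    exact ⟨Preconnected.of_subsingleton⟩
  exact connected_induce_union hS.preconnected this.preconnected hw rfl h

/-- The new vertex `v` may go to any unused neighbour of `p.2`. Adjacency is respected because `v`
and its image each have just one neighbour in the convex domain and range. -/
theorem IsPartialIso.exists_insert (hG : G.IsAcyclic) (hH : H.IsAcyclic)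
    (hinf : ∀ y, (H.neighborSet y).Infinite) (h : IsPartialIso G H r₀ r) {p : X × Y} (hp : p ∈ r)
    {v : X} (hv : G.Adj p.1 v) : ∃ r', IsPartialIso G H r₀ r' ∧ r ⊆ r' ∧ v ∈ Prod.fst '' r' := by
  by_cases hvr : v ∈ Prod.fst '' r
  · exact ⟨r, h, subset_rfl, hvr⟩
  obtain ⟨y, hy, hyr⟩ := ((hinf p.2).sdiff (h.finite.image Prod.snd)).nonempty
  rw [mem_neighborSet] at hy
  have hG' := isConvex_of_preconnected hG h.connected_fst.preconnected
  have hH' := isConvex_of_preconnected hH h.connected_snd.preconnected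
  have hne1 : ∀ q ∈ r, q.1 ≠ v := fun q hq e => hvr ⟨q, hq, e⟩
  have hne2 : ∀ q ∈ r, q.2 ≠ y := fun q hq e => hyr ⟨q, hq, e⟩
  have hadj : ∀ q ∈ r, (G.Adj q.1 v ↔ H.Adj q.2 y) := by
    intro q hq
    constructor
    · intro hqv
      have := hG'.eq_of_adj hvr ⟨q, hq, rfl⟩ ⟨p, hp, rfl⟩ hqv.symm hv.symm
      rw [(h.fst_eq_iff q hq p hp).1 this]
      exact hy
    · intro hqy
      have := hH'.eq_of_adj hyr ⟨q, hq, rfl⟩ ⟨p, hp, rfl⟩ hqy.symm hy.symm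
      rw [(h.fst_eq_iff q hq p hp).2 this]
      exact hv
  refine ⟨insert (v, y) r, ⟨h.subset.trans (Set.subset_insert _ _), h.finite.insert _, ?_, ?_, ?_,
    ?_⟩, Set.subset_insert _ _, ⟨(v, y), Set.mem_insert _ _, rfl⟩⟩
  · rintro a (rfl | ha) b (rfl | hb)
    · simp
    · exact iff_of_false (hne1 b hb).symm (hne2 b hb).symm
    · exact iff_of_false (hne1 a ha) (hne2 a ha)
    · exact h.fst_eq_iff a ha b hb
  · rintro a (rfl | ha) b (rfl | hb)
    · simp
    · right
      rw [G.adj_comm, H.adj_comm]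
      exact hadj b hb
    · exact Or.inr (hadj a ha)
    · exact h.adj_iff a ha b hb
  · rw [Set.image_insert_eq]
    exact connected_induce_insert h.connected_fst ⟨p, hp, rfl⟩ hv
  · rw [Set.image_insert_eq]
    exact connected_induce_insert h.connected_snd ⟨p, hp, rfl⟩ hy

theorem IsPartialIso.exists_mem_fst (hG : G.IsTree) (hH : H.IsAcyclic)
    (hinf : ∀ y, (H.neighborSet y).Infinite) (h : IsPartialIso G H r₀ r) (v : X) :
    ∃ r', IsPartialIso G H r₀ r' ∧ r ⊆ r' ∧ v ∈ Prod.fst '' r' := by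
  obtain ⟨⟨u, hu⟩⟩ := h.connected_fst.nonempty
  obtain ⟨w⟩ := hG.connected u v
  induction w generalizing r with
  | nil => exact ⟨r, h, subset_rfl, hu⟩
  | cons huv q ih =>
    obtain ⟨p, hp, rfl⟩ := hu
    obtain ⟨r', h', hr', hv⟩ := h.exists_insert hG.isAcyclic hH hinf hp huv
    obtain ⟨r'', h'', hr'', hw⟩ := ih h' hv
    exact ⟨r'', h'', hr'.trans hr'', hw⟩

theorem IsPartialIso.exists_mem_snd (hG : G.IsAcyclic) (hH : H.IsTree)
    (hinf : ∀ x, (G.neighborSet x).Infinite) (h : IsPartialIso G H r₀ r) (v : Y) :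
    ∃ r', IsPartialIso G H r₀ r' ∧ r ⊆ r' ∧ v ∈ Prod.snd '' r' := by
  obtain ⟨r', h', hr', p, hp, hpv⟩ := h.swap.exists_mem_fst hH hG hinf v
  have := h'.swap
  simp only [← Set.preimage_comp, Prod.swap_swap_eq, Set.preimage_id] at this
  exact ⟨_, this, fun q hq => hr' (by simpa using hq), p.swap, by simpa using hp, hpv⟩

/-- Only the forth half, so that `G` may be a finite tree without infinite valences; this is how
bi-trees get embedded in `T`. -/
theorem IsPartialIso.exists_univ_fst [Finite X] (hG : G.IsTree) (hH : H.IsAcyclic)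
    (hinf : ∀ y, (H.neighborSet y).Infinite) (h : IsPartialIso G H r₀ r) :
    ∃ r', IsPartialIso G H r₀ r' ∧ r ⊆ r' ∧ ∀ v, v ∈ Prod.fst '' r' := by
  have key : ∀ s : Set X, s.Finite → ∃ r', IsPartialIso G H r₀ r' ∧ r ⊆ r' ∧ s ⊆ Prod.fst '' r' := by
    intro s hs
    induction s, hs using Set.Finite.induction_on with
    | empty => exact ⟨r, h, subset_rfl, Set.empty_subset _⟩
    | @insert v s _ _ ih =>
      obtain ⟨r', h', hr', hs⟩ := ih
      obtain ⟨r'', h'', hr'', hv⟩ := h'.exists_mem_fst hG hH hinf v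
      exact ⟨r'', h'', hr'.trans hr'',
        Set.insert_subset hv (hs.trans (Set.image_mono hr''))⟩
  obtain ⟨r', h', hr', hs⟩ := key Set.univ Set.finite_univ
  exact ⟨r', h', hr', fun v => hs trivial⟩

/-- A partial isomorphism between countable trees of infinite valence extends to a bijection
of their vertices that respects adjacency, except possibly between points in the domain. -/
theorem IsPartialIso.exists_equiv [Countable X] [Countable Y] (hG : G.IsTree) (hH : H.IsTree)
    (hGinf : ∀ x, (G.neighborSet x).Infinite) (hHinf : ∀ y, (H.neighborSet y).Infinite)
    (h : IsPartialIso G H r r) :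
    ∃ e : X ≃ Y, (∀ p ∈ r, e p.1 = p.2) ∧ ∀ a b,
      (a ∈ Prod.fst '' r ∧ b ∈ Prod.fst '' r) ∨ (G.Adj a b ↔ H.Adj (e a) (e b)) := by
  let P := {s : Set (X × Y) // IsPartialIso G H r s}
  let 𝒟 : X ⊕ Y → Order.Cofinal P := Sum.elim
    (fun x => ⟨{s | x ∈ Prod.fst '' s.1}, fun s => by
      obtain ⟨r', h', hr', hv⟩ := s.2.exists_mem_fst hG hH.isAcyclic hHinf x
      exact ⟨⟨r', h'⟩, hv, hr'⟩⟩)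
    (fun y => ⟨{s | y ∈ Prod.snd '' s.1}, fun s => by
      obtain ⟨r', h', hr', hv⟩ := s.2.exists_mem_snd hG.isAcyclic hH hGinf y
      exact ⟨⟨r', h'⟩, hv, hr'⟩⟩)
  have := Encodable.ofCountable (X ⊕ Y)
  -- A generic ideal meeting the countably many cofinal sets replaces the alternating enumeration;
  -- its directedness makes the union of its members the graph of a bijection.
  let K := Order.idealOfCofinals (⟨r, h⟩ : P) 𝒟
  have hfst : ∀ x, ∃ y, ∃ s ∈ K, (x, y) ∈ s.1 := fun x => by
    obtain ⟨s, ⟨⟨x', y⟩, hp, rfl⟩, hs'⟩ :=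
      Order.cofinal_meets_idealOfCofinals (⟨r, h⟩ : P) 𝒟 (Sum.inl x)
    exact ⟨y, s, hs', hp⟩
  have hsnd : ∀ y, ∃ x, ∃ s ∈ K, (x, y) ∈ s.1 := fun y => by
    obtain ⟨s, ⟨⟨x, y'⟩, hp, rfl⟩, hs'⟩ :=
      Order.cofinal_meets_idealOfCofinals (⟨r, h⟩ : P) 𝒟 (Sum.inr y)
    exact ⟨x, s, hs', hp⟩
  have hdir : ∀ s ∈ K, ∀ t ∈ K, ∀ p ∈ s.1, ∀ q ∈ t.1, ∃ w : P, p ∈ w.1 ∧ q ∈ w.1 := by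
    intro s hs t ht p hp q hq
    obtain ⟨w, -, hsw, htw⟩ := K.directed s hs t ht
    exact ⟨w, hsw hp, htw hq⟩
  choose f S hS hf using hfst
  choose g S' hS' hg using hsnd
  have hmem : ∀ p ∈ r, f p.1 = p.2 := by
    intro p hp
    obtain ⟨w, h1, h2⟩ := hdir _ (hS p.1) ⟨r, h⟩ (Order.mem_idealOfCofinals _ _) _ (hf p.1) p hp
    exact (w.2.fst_eq_iff _ h1 _ h2).1 rfl
  refine ⟨⟨f, g, fun x => ?_, fun y => ?_⟩, hmem, fun a b => ?_⟩
  · obtain ⟨w, h1, h2⟩ := hdir _ (hS x) _ (hS' (f x)) _ (hf x) _ (hg (f x))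
    exact ((w.2.fst_eq_iff _ h1 _ h2).2 rfl).symm
  · obtain ⟨w, h1, h2⟩ := hdir _ (hS (g y)) _ (hS' y) _ (hf (g y)) _ (hg y)
    exact (w.2.fst_eq_iff _ h1 _ h2).1 rfl
  · obtain ⟨w, h1, h2⟩ := hdir _ (hS a) _ (hS b) _ (hf a) _ (hf b)
    exact (w.2.adj_iff _ h1 _ h2).imp (fun h => ⟨⟨_, h.1, rfl⟩, ⟨_, h.2, rfl⟩⟩) id

end Extension


/-! ### Spheromorphisms as pairs of trees, and their bi-trees -/

section Spheromorphism

variable {V : Type u} {T : SimpleGraph V} {I J : T.Subgraph} {g : Equiv.Perm V}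

theorem mk_mem_cutEdges {a b : V} :
    s(a, b) ∈ cutEdges T g ↔ T.Adj a b ∧ ¬ T.Adj (g a) (g b) := Iff.rfl

theorem deleteEdges_cutEdges : T.deleteEdges (cutEdges T g) = T ⊓ T.comap g := by
  ext a b
  simp only [deleteEdges_adj, mk_mem_cutEdges, inf_adj, comap_adj]
  tauto

theorem fromEdgeSet_cutEdges_adj {a b : V} :
    (fromEdgeSet (cutEdges T g)).Adj a b ↔ T.Adj a b ∧ ¬ T.Adj (g a) (g b) := by
  rw [fromEdgeSet_adj, mk_mem_cutEdges]
  exact ⟨And.left, fun h => ⟨h, h.1.ne⟩⟩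

theorem mk_mem_imageCutEdges {a b : V} :
    s(g a, g b) ∈ imageCutEdges T g ↔ T.Adj (g a) (g b) ∧ ¬ T.Adj a b := by
  have h : s(g a, g b) = Sym2.map g s(a, b) := rfl
  unfold imageCutEdges
  rw [Set.mem_sdiff, h, (Sym2.map.injective g.injective).mem_set_image, Set.mem_sdiff,
    mk_mem_cutEdges, ← h, mem_edgeSet, mem_edgeSet]
  tauto

theorem fromEdgeSet_imageCutEdges_adj {a b : V} :
    (fromEdgeSet (imageCutEdges T g)).Adj (g a) (g b) ↔ T.Adj (g a) (g b) ∧ ¬ T.Adj a b := by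
  rw [fromEdgeSet_adj, mk_mem_imageCutEdges]
  exact ⟨And.left, fun h => ⟨h, h.1.ne⟩⟩

theorem mem_ends_iff {E : Set (Sym2 V)} {v : V} : v ∈ ends E ↔ ∃ w, s(v, w) ∈ E := by
  constructor
  · rintro ⟨e, he, w, rfl⟩
    exact ⟨w, he⟩
  · rintro ⟨w, h⟩
    exact ⟨_, h, Sym2.mem_mk_left v w⟩

theorem ends_cutEdges : ends (cutEdges T g) = diffEnds T (T.comap g) := by
  ext v
  exact mem_ends_iff

theorem preimage_ends_imageCutEdges :
    g ⁻¹' ends (imageCutEdges T g) = diffEnds (T.comap g) T := by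
  ext v
  rw [Set.mem_preimage, mem_ends_iff]
  constructor
  · rintro ⟨w, h⟩
    obtain ⟨w, rfl⟩ := g.surjective w
    exact ⟨w, mk_mem_imageCutEdges.1 h⟩
  · rintro ⟨w, h⟩
    exact ⟨g w, mk_mem_imageCutEdges.2 h⟩

theorem isTree_comap (hT : T.IsTree) (g : Equiv.Perm V) : (T.comap g).IsTree :=
  (Iso.comap g T).isTree_iff.2 hT

theorem sourceSkeleton_eq (hT : T.IsTree) (I : T.Subgraph) (g : Equiv.Perm V) :
    sourceSkeleton I g = closure T (I.verts ∪ diffEnds T (T.comap g)) := by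
  rw [sourceSkeleton, closure_eq_hull hT, ends_cutEdges]

theorem preimage_targetSkeleton (hT : T.IsTree) (J : T.Subgraph) (g : Equiv.Perm V) :
    g ⁻¹' targetSkeleton J g =
      closure (T.comap g) (g ⁻¹' J.verts ∪ diffEnds (T.comap g) T) := by
  rw [targetSkeleton, ← closure_eq_hull hT, ← closure_comap_equiv, Set.preimage_union,
    preimage_ends_imageCutEdges]

theorem isConvex_supp {F : SimpleGraph V} (hF : F ≤ T) (hT : T.IsAcyclic)
    (S : F.ConnectedComponent) : IsConvex T S.supp := by
  refine isConvex_of_preconnected hT (Preconnected.mono (comap_monotone _ hF) ?_)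
  exact S.connected_toSimpleGraph.preconnected

/-- The convex closure in a subforest of a tree is assembled from hulls in the components. -/
theorem iUnion_hull_eq_closure {F : SimpleGraph V} (hF : F ≤ T) (hT : T.IsTree) (A : Set V) :
    ⋃ S : F.ConnectedComponent, hull T (S.supp ∩ A) = closure F A := by
  have hsupp : ∀ S : F.ConnectedComponent, hull T (S.supp ∩ A) ⊆ S.supp := fun S => by
    rw [← closure_eq_hull hT]
    exact closure_subset Set.inter_subset_left (isConvex_supp hF hT.isAcyclic S)
  apply Set.Subset.antisymm
  · refine Set.iUnion_subset fun S => ?_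
    have hcl : hull T (S.supp ∩ A) ⊆ closure F A ∩ S.supp := by
      rw [← closure_eq_hull hT]
      refine closure_subset (fun x hx => ⟨subset_closure hx.2, hx.1⟩) ?_
      intro a ha b hb p hp x hx
      refine ⟨?_, isConvex_supp hF hT.isAcyclic S ha.2 hb.2 p hp x hx⟩
      -- Within one component the `T`-path is the `F`-path, so convexity in `F` applies to it.
      obtain ⟨q, hq⟩ := (S.reachable_of_mem_supp ha.2 hb.2).exists_isPath
      have := congrArg Subtype.val
        ((hT.isAcyclic.subsingleton_path a b).elim ⟨p, hp⟩ ⟨_, hq.mapLe hF⟩)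
      simp only at this
      rw [this] at hx
      exact isConvex_closure ha.1 hb.1 q hq x (by simpa using hx)
    exact hcl.trans Set.inter_subset_left
  · refine closure_subset (fun a ha => Set.mem_iUnion.2 ⟨F.connectedComponentMk a,
      subset_hull _ _ ⟨rfl, ha⟩⟩) ?_
    intro a ha b hb p hp x hx
    obtain ⟨S, hS⟩ := Set.mem_iUnion.1 ha
    obtain ⟨S', hS'⟩ := Set.mem_iUnion.1 hb
    have h1 : F.connectedComponentMk a = S := hsupp S hS
    have h2 : F.connectedComponentMk b = S' := hsupp S' hS'
    have h3 : S = S' := by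
      rw [← h1, ← h2]
      exact ConnectedComponent.sound p.reachable
    subst h3
    refine Set.mem_iUnion.2 ⟨S, ?_⟩
    rw [← closure_eq_hull hT] at hS hS' ⊢
    exact isConvex_closure hS hS' (p.mapLe hF) (hp.mapLe hF) x (by simpa using hx)

/-- Everything on the target side is pulled back along `g`, so that both skeletons live on the same
vertex set. -/
theorem blackVerts_eq_core (hT : T.IsTree) (I J : T.Subgraph) (g : Equiv.Perm V) :
    blackVerts I J g = core T (T.comap g) I.verts (g ⁻¹' J.verts) := by
  rw [blackVerts, iUnion_hull_eq_closure (deleteEdges_le _) hT, sourceSkeleton_eq hT,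
    preimage_targetSkeleton hT, deleteEdges_cutEdges, core]

theorem finite_ends {E : Set (Sym2 V)} (hE : E.Finite) : (ends E).Finite := by
  classical
  have : ends E = ⋃ e ∈ E, (e.toFinset : Set V) := by
    ext v
    simp [ends]
  rw [this]
  exact hE.biUnion fun e _ => e.toFinset.finite_toSet

theorem finite_diffEnds (hg : IsSpheromorphism T g) : (diffEnds T (T.comap g)).Finite := by
  rw [← ends_cutEdges]
  exact finite_ends ((isPerfect_iff hg _).2 rfl).1.finite

theorem finite_diffEnds' (hg : IsSpheromorphism T g) : (diffEnds (T.comap g) T).Finite := by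
  have h := diffEnds_comap g T (T.comap (g⁻¹ : Equiv.Perm V))
  have h2 : (T.comap (g⁻¹ : Equiv.Perm V)).comap g = T := by
    ext a b
    simp
  rw [h2] at h
  rw [h]
  exact (finite_diffEnds hg.inv).preimage g.injective.injOn

theorem biTreeOf_black_adj {a b : blackVerts I J g} :
    (biTreeOf I J g).black.Adj a b ↔ T.Adj a.1 b.1 ∧ T.Adj (g a.1) (g b.1) := by
  change (T.deleteEdges (cutEdges T g)).Adj a.1 b.1 ↔ _
  rw [deleteEdges_cutEdges]
  rfl

theorem biTreeOf_blue_adj {a b : blackVerts I J g} :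
    (biTreeOf I J g).blue.Adj a b ↔ T.Adj a.1 b.1 ∧ ¬ T.Adj (g a.1) (g b.1) :=
  fromEdgeSet_cutEdges_adj

theorem biTreeOf_red_adj {a b : blackVerts I J g} :
    (biTreeOf I J g).red.Adj a b ↔ T.Adj (g a.1) (g b.1) ∧ ¬ T.Adj a.1 b.1 :=
  fromEdgeSet_imageCutEdges_adj

theorem biTreeOf_black_sup_blue :
    (biTreeOf I J g).black ⊔ (biTreeOf I J g).blue = T.induce (blackVerts I J g) := by
  ext a b
  refine (sup_adj _ _ _ _).trans
    ((or_congr biTreeOf_black_adj biTreeOf_blue_adj).trans ?_)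
  change _ ↔ T.Adj a.1 b.1
  tauto

theorem biTreeOf_black_sup_red :
    (biTreeOf I J g).black ⊔ (biTreeOf I J g).red = (T.comap g).induce (blackVerts I J g) := by
  ext a b
  refine (sup_adj _ _ _ _).trans
    ((or_congr biTreeOf_black_adj biTreeOf_red_adj).trans ?_)
  change _ ↔ T.Adj (g a.1) (g b.1)
  tauto

theorem biTreeOf_sup_adj {a b : blackVerts I J g} :
    ((biTreeOf I J g).black ⊔ (biTreeOf I J g).blue ⊔ (biTreeOf I J g).red).Adj a b ↔
      T.Adj a.1 b.1 ∨ T.Adj (g a.1) (g b.1) := by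
  rw [biTreeOf_black_sup_blue]
  refine (sup_adj _ _ _ _).trans ((or_congr Iff.rfl biTreeOf_red_adj).trans ?_)
  change T.Adj a.1 b.1 ∨ _ ↔ _
  tauto

theorem exists_adj_of_preconnected {X : Type*} {G : SimpleGraph X} (hG : G.Preconnected) {v w : X}
    (h : v ≠ w) : ∃ z, G.Adj v z := by
  obtain ⟨p⟩ := hG v w
  cases p with
  | nil => exact absurd rfl h
  | cons h _ => exact ⟨_, h⟩

theorem isBiTree_biTreeOf (hT : T.IsTree) (hI : I.verts.Nonempty) (hIfin : I.verts.Finite)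
    (hJ : J.verts.Nonempty) (hJfin : J.verts.Finite) (hg : IsSpheromorphism T g) :
    (biTreeOf I J g).IsBiTree := by
  have hT' := isTree_comap hT g
  have hJ' : (g ⁻¹' J.verts).Nonempty := hJ.preimage g.surjective
  have hcore := blackVerts_eq_core hT I J g
  have hBconn : (T.induce (blackVerts I J g)).Preconnected := by
    rw [hcore]
    exact preconnected_core hT.connected hI
  have hRconn : ((T.comap g).induce (blackVerts I J g)).Preconnected := by
    rw [hcore, core_comm]
    exact preconnected_core hT'.connected hJ'
  have hne : Nonempty (blackVerts I J g) := by
    obtain ⟨i, hi⟩ := hI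
    rw [hcore]
    exact ⟨i, left_subset_core hi⟩
  refine ⟨?_, ?_, ?_, ?_, ?_, ?_, ?_, ?_⟩
  · change Finite (blackVerts I J g)
    rw [hcore]
    exact finite_core hT hT' hIfin (hJfin.preimage g.injective.injOn) (finite_diffEnds hg)
      (finite_diffEnds' hg)
  · rw [biTreeOf_black_sup_blue]
    exact ⟨@Connected.mk _ _ hBconn hne, hT.isAcyclic.induce _⟩
  · rw [biTreeOf_black_sup_red]
    exact ⟨@Connected.mk _ _ hRconn hne, hT'.isAcyclic.induce _⟩
  · exact fun a b h => Subtype.ext (congrArg (fun x : blackVerts I J g => x.1) h)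
  · intro a b h
    rw [biTreeOf_black_sup_blue]
    exact I.adj_sub h
  · exact fun a b h =>
      Subtype.ext (g⁻¹.injective (congrArg (fun x : blackVerts I J g => x.1) h))
  · intro a b h
    rw [biTreeOf_black_sup_red]
    change T.Adj (g (g⁻¹ a.1)) (g (g⁻¹ b.1))
    simpa using J.adj_sub h
  · rintro ⟨v, hv⟩ hcard
    obtain ⟨⟨w, hw⟩, hvw⟩ := Set.ncard_eq_one.1 hcard
    have hnbr : ∀ z ∈ blackVerts I J g, T.Adj v z ∨ T.Adj (g v) (g z) → z = w := fun z hz h =>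
      congrArg (fun x : blackVerts I J g => x.1)
        ((Set.ext_iff.1 hvw ⟨z, hz⟩).1 (biTreeOf_sup_adj.2 h))
    have hne : v ≠ w := by
      have h := biTreeOf_sup_adj.1 ((Set.ext_iff.1 hvw ⟨w, hw⟩).2 rfl)
      rintro rfl
      exact h.elim (fun h => h.ne rfl) (fun h => h.ne rfl)
    have hne' : (⟨v, hv⟩ : blackVerts I J g) ≠ ⟨w, hw⟩ := fun e => hne (congrArg Subtype.val e)
    -- Each of the two trees has an edge at `v`. Both edges must end at the sole neighbour `w`, so
    -- the edge is black.
    have hB : T.Adj v w := by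
      obtain ⟨⟨z, hz⟩, h⟩ := exists_adj_of_preconnected hBconn hne'
      have h : T.Adj v z := h
      rwa [hnbr z hz (Or.inl h)] at h
    have hR : T.Adj (g v) (g w) := by
      obtain ⟨⟨z, hz⟩, h⟩ := exists_adj_of_preconnected hRconn hne'
      have h : T.Adj (g v) (g z) := h
      rwa [hnbr z hz (Or.inr h)] at h
    refine ⟨⟨⟨w, hw⟩, biTreeOf_black_adj.2 ⟨hB, hR⟩⟩, ?_⟩
    rw [hcore] at hnbr
    -- The far end of a blue edge at `v` is also in the core, so it is `w`; but the edge to `w` is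
    -- black.
    have hvB : v ∉ diffEnds T (T.comap g) := by
      rintro ⟨z, h1, h2⟩
      have hz : z ∈ core T (T.comap g) I.verts (g ⁻¹' J.verts) :=
        diffEnds_subset_core ⟨v, h1.symm, fun h => h2 h.symm⟩
      rw [hnbr z hz (Or.inl h1)] at h2
      exact h2 hR
    have hvR : v ∉ diffEnds (T.comap g) T := by
      rintro ⟨z, h1, h2⟩
      have hz : z ∈ core T (T.comap g) I.verts (g ⁻¹' J.verts) :=
        diffEnds_subset_core' ⟨v, h1.symm, fun h => h2 h.symm⟩
      rw [hnbr z hz (Or.inr h1)] at h2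
      exact h2 hB
    refine (mem_of_unique_adj (hcore ▸ hv) hvB hvR fun y hy z hz h h' =>
      (hnbr y hy (Or.inl h)).trans (hnbr z hz (Or.inl h')).symm).imp
      (fun h => ⟨⟨v, h⟩, rfl⟩) (fun h => ⟨⟨g v, h⟩, Subtype.ext ?_⟩)
    exact g.symm_apply_apply v

end Spheromorphism


/-! ### Double cosets and equivalence classes of bi-trees -/

section Main

variable {V : Type u} {T : SimpleGraph V} {I J : T.Subgraph} {g : Equiv.Perm V}

theorem connected_induce_range {X Y : Type*} {G : SimpleGraph X} {H : SimpleGraph Y}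
    (hG : G.Connected) (f : G →g H) : (H.induce (Set.range f)).Connected :=
  hG.map (⟨fun x => ⟨f x, x, rfl⟩, fun h => f.map_adj h⟩ : G →g H.induce (Set.range f))
    (by rintro ⟨_, x, rfl⟩; exact ⟨x, rfl⟩)

/-- The two image trees need not be isomorphic: adjacency inside them is left free, which is where
blue and red edges arise. -/
theorem exists_perm_extending (hT : IsCountableValenceTree T) {Z : Type*} [Finite Z]
    {f f' : Z → V} (hf : Function.Injective f) (hf' : Function.Injective f')
    (hc : (T.induce (Set.range f)).Connected) (hc' : (T.induce (Set.range f')).Connected) :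
    ∃ g : Equiv.Perm V, (∀ z, g (f z) = f' z) ∧
      ∀ a b, (a ∈ Set.range f ∧ b ∈ Set.range f) ∨ (T.Adj a b ↔ T.Adj (g a) (g b)) := by
  have := countable_of_isCountableValenceTree hT
  have h1 : Prod.fst '' (Set.range fun z => (f z, f' z)) = Set.range f := by
    rw [← Set.range_comp]; rfl
  have h2 : Prod.snd '' (Set.range fun z => (f z, f' z)) = Set.range f' := by
    rw [← Set.range_comp]; rfl
  have h : IsPartialIso T T (Set.range fun z => (f z, f' z)) (Set.range fun z => (f z, f' z)) := by
    refine ⟨subset_rfl, Set.finite_range _, ?_, fun p hp q hq => Or.inl ⟨hp, hq⟩, ?_, ?_⟩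
    · rintro _ ⟨z, rfl⟩ _ ⟨w, rfl⟩
      exact hf.eq_iff.trans hf'.eq_iff.symm
    · rwa [h1]
    · rwa [h2]
  obtain ⟨g, hg, hg'⟩ := h.exists_equiv hT.isTree hT.isTree hT.infinite hT.infinite
  rw [h1] at hg'
  exact ⟨g, fun z => hg _ ⟨z, rfl⟩, hg'⟩

theorem exists_embedding (hT : IsCountableValenceTree T) {Z : Type*} [Finite Z]
    {G : SimpleGraph Z} (hG : G.IsTree) (hI : I.coe.IsTree) (hIfin : I.verts.Finite)
    (ι : I.verts → Z) (hι : Function.Injective ι) (hadj : ∀ a b, I.coe.Adj a b → G.Adj (ι a) (ι b)) :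
    ∃ f : Z → V, Function.Injective f ∧ (∀ a b, T.Adj (f a) (f b) ↔ G.Adj a b) ∧
      (T.induce (Set.range f)).Connected ∧ ∀ a, f (ι a) = a := by
  have := hIfin.to_subtype
  have h1 : Prod.fst '' (Set.range fun a : I.verts => (ι a, a.1)) = Set.range ι := by
    rw [← Set.range_comp]; rfl
  have h2 : Prod.snd '' (Set.range fun a : I.verts => (ι a, a.1)) =
      Set.range (fun a : I.verts => a.1) := by
    rw [← Set.range_comp]; rfl
  let φ : I.coe →g G := ⟨ι, fun h => hadj _ _ h⟩
  have h : IsPartialIso G T (Set.range fun a : I.verts => (ι a, a.1))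
      (Set.range fun a : I.verts => (ι a, a.1)) := by
    refine ⟨subset_rfl, Set.finite_range _, ?_, fun p hp q hq => Or.inl ⟨hp, hq⟩, ?_, ?_⟩
    · rintro _ ⟨z, rfl⟩ _ ⟨w, rfl⟩
      exact hι.eq_iff.trans Subtype.val_injective.eq_iff.symm
    · rw [h1]
      exact connected_induce_range hI.connected φ
    · rw [h2]
      exact connected_induce_range hI.connected I.hom
  obtain ⟨r, hr, -, hr'⟩ := h.exists_univ_fst hG hT.isTree.isAcyclic hT.infinite
  have hex : ∀ z, ∃ v, (z, v) ∈ r := fun z => by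
    obtain ⟨⟨z, v⟩, hp, rfl⟩ := hr' z
    exact ⟨v, hp⟩
  choose f hf using hex
  refine ⟨f, fun a b hab => (hr.fst_eq_iff _ (hf a) _ (hf b)).2 hab, fun a b => ?_, ?_, fun a => ?_⟩
  -- Exempt pairs come from `I`. There, adjacency in either tree is adjacency in `I`, because `I` is
  -- connected and embeds in both.
  · rcases hr.adj_iff _ (hf a) _ (hf b) with ⟨⟨x, hx⟩, y, hy⟩ | h
    · obtain ⟨rfl, hx⟩ := Prod.mk.inj hx
      obtain ⟨rfl, hy⟩ := Prod.mk.inj hy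
      rw [← hx, ← hy]
      have h3 : T.Adj x.1 y.1 → I.coe.Adj x y :=
        adj_of_adj_map hI.connected.preconnected hT.isTree.isAcyclic I.hom I.hom_injective
      have h4 : G.Adj (ι x) (ι y) → I.coe.Adj x y :=
        adj_of_adj_map hI.connected.preconnected hG.isAcyclic φ hι
      exact ⟨fun h => hadj _ _ (h3 h), fun h => I.adj_sub (h4 h)⟩
    · exact h.symm
  · have : Set.range f = Prod.snd '' r := by
      ext v
      constructor
      · rintro ⟨z, rfl⟩
        exact ⟨_, hf z, rfl⟩
      · rintro ⟨⟨z, v⟩, hp, rfl⟩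
        exact ⟨z, (hr.fst_eq_iff _ (hf z) _ hp).1 rfl⟩
    rw [this]
    exact hr.connected_snd
  · exact (hr.fst_eq_iff _ (hf _) _ (hr.subset ⟨a, rfl⟩)).1 rfl

theorem perm_apply_inv (g : Equiv.Perm V) (v : V) : g (g⁻¹ v) = v := g.apply_symm_apply v

theorem preimage_verts_of_mem_stab {k : Hier T} (hk : k ∈ stab I) : k.1 ⁻¹' I.verts = I.verts := by
  ext v
  constructor
  · intro hv
    have h := hk.2 _ hv
    rw [Set.mem_preimage, k.1.injective h] at hv
    exact hv
  · intro hv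
    rw [Set.mem_preimage, hk.2 v hv]
    exact hv

theorem comap_eq_of_mem_stab {k : Hier T} (hk : k ∈ stab I) : T.comap k.1 = T := by
  ext a b
  exact hk.1 a b

/-- As `l` preserves `T`, the second tree of `l * g * k` is the pullback along `k` of that of `g`;
the first tree and the marks are preserved too, so `k` is the equivalence. -/
theorem equivalent_biTreeOf_mul (hT : T.IsTree) {l k : Hier T} (hl : l ∈ stab J) (hk : k ∈ stab I)
    (g : Hier T) : (biTreeOf I J (l * g * k).1).Equivalent (biTreeOf I J g.1) := by
  have hmul : ∀ v, (l * g * k).1 v = l.1 (g.1 (k.1 v)) := fun _ => rfl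
  have hverts : ∀ v, v ∈ blackVerts I J (l * g * k).1 ↔ k.1 v ∈ blackVerts I J g.1 := by
    intro v
    have h1 : T.comap (l * g * k).1 = (T.comap g.1).comap k.1 := by
      ext a b
      exact hl.1 _ _
    have h2 : (l * g * k).1 ⁻¹' J.verts = k.1 ⁻¹' (g.1 ⁻¹' J.verts) := by
      conv_rhs => rw [← preimage_verts_of_mem_stab hl]
      rfl
    have h3 := core_comap k.1 T (T.comap g.1) I.verts (g.1 ⁻¹' J.verts)
    rw [comap_eq_of_mem_stab hk, preimage_verts_of_mem_stab hk, ← h1, ← h2,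
      ← blackVerts_eq_core hT, ← blackVerts_eq_core hT] at h3
    rw [h3]
    rfl
  have hg : ∀ a b, T.Adj ((l * g * k).1 a) ((l * g * k).1 b) ↔
      T.Adj (g.1 (k.1 a)) (g.1 (k.1 b)) := fun a b => hl.1 _ _
  refine ⟨k.1.subtypeEquiv hverts, fun a b => ?_, fun a b => ?_, fun a b => ?_, fun a => ?_,
    fun a => ?_⟩
  · refine biTreeOf_black_adj.trans (Iff.trans ?_ biTreeOf_black_adj.symm)
    exact and_congr (hk.1 _ _) (hg _ _).symm
  · refine biTreeOf_blue_adj.trans (Iff.trans ?_ biTreeOf_blue_adj.symm)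
    exact and_congr (hk.1 _ _) (not_congr (hg _ _).symm)
  · refine biTreeOf_red_adj.trans (Iff.trans ?_ biTreeOf_red_adj.symm)
    exact and_congr (hg _ _).symm (not_congr (hk.1 _ _))
  · exact Subtype.ext (hk.2 _ a.2).symm
  · refine Subtype.ext ?_
    change g.1⁻¹ a.1 = k.1 ((l * g * k).1⁻¹ a.1)
    apply g.1.injective
    apply l.1.injective
    rw [← hmul, perm_apply_inv, perm_apply_inv]
    exact hl.2 _ a.2

theorem adj_iff_of_notMem_blackVerts (hT : T.IsTree) {a b : V}
    (h : ¬ (a ∈ blackVerts I J g ∧ b ∈ blackVerts I J g)) : T.Adj (g a) (g b) ↔ T.Adj a b := by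
  rw [blackVerts_eq_core hT] at h
  constructor
  · intro h1
    by_contra h2
    exact h ⟨diffEnds_subset_core' ⟨b, h1, h2⟩,
      diffEnds_subset_core' ⟨a, h1.symm, fun h => h2 h.symm⟩⟩
  · intro h1
    by_contra h2
    exact h ⟨diffEnds_subset_core ⟨b, h1, h2⟩,
      diffEnds_subset_core ⟨a, h1.symm, fun h => h2 h.symm⟩⟩

theorem connected_induce_blackVerts (hB : (biTreeOf I J g).IsBiTree) :
    (T.induce (blackVerts I J g)).Connected := by
  have := hB.black_blue_isTree.connected
  rwa [biTreeOf_black_sup_blue] at this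

theorem exists_mul_eq_of_equivalent (hT : IsCountableValenceTree T) {g h : Hier T}
    (hg : (biTreeOf I J g.1).IsBiTree) (hh : (biTreeOf I J h.1).IsBiTree)
    (e : (biTreeOf I J g.1).Equivalent (biTreeOf I J h.1)) :
    ∃ l ∈ stab J, ∃ k ∈ stab I, h = l * g * k := by
  obtain ⟨e, hblack, hblue, hred, hι, hj⟩ := e
  have hfin : Finite (blackVerts I J g.1) := hg.finite
  let f : blackVerts I J g.1 → V := fun a => a.1
  let f' : blackVerts I J g.1 → V := fun a => (e a).1
  have hr : Set.range f = blackVerts I J g.1 := Subtype.range_coe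
  have hr' : Set.range f' = blackVerts I J h.1 := by
    ext v
    constructor
    · rintro ⟨a, rfl⟩
      exact (e a).2
    · intro hv
      obtain ⟨a, ha⟩ := e.surjective ⟨v, hv⟩
      exact ⟨a, congrArg (fun x : blackVerts I J h.1 => x.1) ha⟩
  have hf'inj : Function.Injective f' := fun a b hab => e.injective (Subtype.ext hab)
  obtain ⟨k, hk, hk'⟩ := exists_perm_extending hT (f := f) (f' := f') Subtype.val_injective
    hf'inj
    (by rw [hr]; exact connected_induce_blackVerts hg)
    (by rw [hr']; exact connected_induce_blackVerts hh)
  rw [hr] at hk'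
  have hkmem : ∀ a, k a ∈ blackVerts I J h.1 ↔ a ∈ blackVerts I J g.1 := by
    intro a
    constructor
    · intro ha
      rw [← hr'] at ha
      obtain ⟨z, hz⟩ := ha
      rw [← hk z] at hz
      rw [← k.injective hz]
      exact z.2
    · intro ha
      have := hk ⟨a, ha⟩
      change k a = _ at this
      rw [this]
      exact (e ⟨a, ha⟩).2
  have hTk : ∀ a b, T.Adj (k a) (k b) ↔ T.Adj a b := by
    intro a b
    rcases hk' a b with ⟨ha, hb⟩ | h1
    · have h1 := (or_congr (hblack ⟨a, ha⟩ ⟨b, hb⟩) (hblue ⟨a, ha⟩ ⟨b, hb⟩))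
      have h2 := ((or_congr biTreeOf_black_adj biTreeOf_blue_adj).symm.trans h1).trans
        (or_congr biTreeOf_black_adj biTreeOf_blue_adj)
      have ha' : k a = (e ⟨a, ha⟩).1 := hk ⟨a, ha⟩
      have hb' : k b = (e ⟨b, hb⟩).1 := hk ⟨b, hb⟩
      rw [← ha', ← hb'] at h2
      simp only at h2
      tauto
    · exact h1.symm
  -- On the core this is the preservation of black and red edges. Elsewhere the two trees agree, so
  -- it reduces to `hTk`.
  have hRk : ∀ a b, T.Adj (h.1 (k a)) (h.1 (k b)) ↔ T.Adj (g.1 a) (g.1 b) := by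
    intro a b
    by_cases hab : a ∈ blackVerts I J g.1 ∧ b ∈ blackVerts I J g.1
    · obtain ⟨ha, hb⟩ := hab
      have h1 := (or_congr (hblack ⟨a, ha⟩ ⟨b, hb⟩) (hred ⟨a, ha⟩ ⟨b, hb⟩))
      have h2 := ((or_congr biTreeOf_black_adj biTreeOf_red_adj).symm.trans h1).trans
        (or_congr biTreeOf_black_adj biTreeOf_red_adj)
      have ha' : k a = (e ⟨a, ha⟩).1 := hk ⟨a, ha⟩
      have hb' : k b = (e ⟨b, hb⟩).1 := hk ⟨b, hb⟩
      rw [← ha', ← hb'] at h2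
      simp only at h2
      tauto
    · rw [adj_iff_of_notMem_blackVerts hT.isTree hab,
        adj_iff_of_notMem_blackVerts (I := I) (J := J) hT.isTree (by rwa [hkmem, hkmem]), hTk]
  have hkI : ∀ v ∈ I.verts, k v = v := by
    intro v hv
    have h1 : v = (e ((biTreeOf I J g.1).ι ⟨v, hv⟩)).1 :=
      congrArg (fun x : blackVerts I J h.1 => x.1) (hι ⟨v, hv⟩)
    conv_rhs => rw [h1]
    exact hk ((biTreeOf I J g.1).ι ⟨v, hv⟩)
  have hkJ : ∀ v ∈ J.verts, k (g.1⁻¹ v) = h.1⁻¹ v := by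
    intro v hv
    have h1 : h.1⁻¹ v = (e ((biTreeOf I J g.1).j ⟨v, hv⟩)).1 :=
      congrArg (fun x : blackVerts I J h.1 => x.1) (hj ⟨v, hv⟩)
    rw [h1]
    exact hk ((biTreeOf I J g.1).j ⟨v, hv⟩)
  let k₀ : Hier T := ⟨k, ∅, ∅, ⟨Set.empty_subset _, Set.finite_empty⟩,
    ⟨Set.empty_subset _, Set.finite_empty⟩, fun a b => by simpa using hTk a b⟩
  have hk₀ : k₀ ∈ stab I := ⟨hTk, hkI⟩
  -- The left factor is forced by the choice of `k₀⁻¹` on the right; `hRk` makes it an automorphism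
  -- and `hkJ` makes it fix `J`.
  refine ⟨h * k₀ * g⁻¹, ⟨fun a b => ?_, fun v hv => ?_⟩, k₀⁻¹, inv_mem hk₀, by group⟩
  · change T.Adj (h.1 (k (g.1⁻¹ a))) (h.1 (k (g.1⁻¹ b))) ↔ _
    rw [hRk, perm_apply_inv, perm_apply_inv]
  · change h.1 (k (g.1⁻¹ v)) = v
    rw [hkJ v hv, perm_apply_inv]

theorem isCoveringForest_inter {W : Set V} (hW : W.Finite) :
    IsCoveringForest T (T.edgeSet ∩ {e | ∀ v ∈ e, v ∈ W}) where
  subset := Set.inter_subset_left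
  finite := by
    refine ((hW.prod hW).image fun p => s(p.1, p.2)).subset ?_
    rintro e ⟨-, he⟩
    induction e with
    | _ a b => exact ⟨(a, b), ⟨he a (by simp), he b (by simp)⟩, rfl⟩

/-- It suffices to cut the edges inside `W` in the source and those inside `g '' W` in the target.
-/
theorem isSpheromorphism_of_adj_iff {W : Set V} (hW : W.Finite)
    (h : ∀ a b, (a ∈ W ∧ b ∈ W) ∨ (T.Adj a b ↔ T.Adj (g a) (g b))) : IsSpheromorphism T g := by
  refine ⟨_, _, isCoveringForest_inter hW, isCoveringForest_inter (hW.image g), fun a b => ?_⟩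
  have h1 := h a b
  simp only [deleteEdges_adj, Set.mem_inter_iff, mem_edgeSet, Set.mem_ofPred_eq, Sym2.mem_iff,
    forall_eq_or_imp, forall_eq, g.injective.mem_set_image]
  tauto

theorem exists_biTreeOf_equivalent (hT : IsCountableValenceTree T) (hI : I.coe.IsTree)
    (hIfin : I.verts.Finite) (hJ : J.coe.IsTree) (hJfin : J.verts.Finite) (Γ : MarkedGraph I J)
    (hΓ : Γ.IsBiTree) : ∃ g : Hier T, Γ.Equivalent (biTreeOf I J g.1) := by
  have := hΓ.finite
  obtain ⟨f, hf, hfadj, hfc, hfι⟩ := exists_embedding hT hΓ.black_blue_isTree hI hIfin Γ.ι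
    hΓ.ι_injective hΓ.ι_adj
  obtain ⟨f', hf', hfadj', hfc', hfj⟩ := exists_embedding hT hΓ.black_red_isTree hJ hJfin Γ.j
    hΓ.j_injective hΓ.j_adj
  obtain ⟨g, hg, hg'⟩ := exists_perm_extending hT hf hf' hfc hfc'
  have hsph := isSpheromorphism_of_adj_iff (Set.finite_range f) hg'
  have hRadj : ∀ a b, T.Adj (g (f a)) (g (f b)) ↔ (Γ.black ⊔ Γ.red).Adj a b := fun a b => by
    rw [hg, hg, hfadj']
  have hpre : g ⁻¹' Set.range f' = Set.range f := by
    ext v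
    constructor
    · rintro ⟨z, hz⟩
      rw [← hg] at hz
      exact ⟨z, g.injective hz⟩
    · rintro ⟨z, rfl⟩
      exact ⟨z, (hg z).symm⟩
  have hdB : diffEnds T (T.comap g) ⊆ Set.range f := by
    rintro v ⟨w, h1, h2⟩
    exact (hg' v w).elim And.left fun h => absurd (h.1 h1) h2
  have hdR : diffEnds (T.comap g) T ⊆ Set.range f := by
    rintro v ⟨w, h1, h2⟩
    exact (hg' v w).elim And.left fun h => absurd (h.2 h1) h2
  have hJj : ∀ v (hv : g v ∈ J.verts), f (Γ.j ⟨g v, hv⟩) = v := fun v hv =>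
    g.injective ((hg _).trans (hfj ⟨g v, hv⟩))
  have hblue : ∀ a b, Γ.blue.Adj a b → ¬ (Γ.black ⊔ Γ.red).Adj a b := by
    rintro a b h (h' | h')
    · exact disjoint_left.1 Γ.black_blue a b h' h
    · exact disjoint_left.1 Γ.blue_red a b h h'
  have hred : ∀ a b, Γ.red.Adj a b → ¬ (Γ.black ⊔ Γ.blue).Adj a b := by
    rintro a b h (h' | h')
    · exact disjoint_left.1 Γ.black_red a b h' h
    · exact disjoint_left.1 Γ.blue_red a b h' h
  -- This is where the valence condition on bi-trees enters: without it the embedded graph could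
  -- exceed the core.
  have hcore : blackVerts I J g = Set.range f := by
    rw [blackVerts_eq_core hT.isTree]
    refine core_eq_of_forall_unique_adj hT.isTree (Set.finite_range f)
      (isConvex_of_preconnected hT.isTree.isAcyclic hfc.preconnected) ?_ ?_
      (fun v hv => ⟨_, hfι ⟨v, hv⟩⟩) (fun v hv => ⟨_, hJj v hv⟩) hdB hdR ?_
    · rw [← hpre, IsConvex.comap_equiv]
      exact isConvex_of_preconnected hT.isTree.isAcyclic hfc'.preconnected
    · obtain ⟨i⟩ := hI.connected.nonempty
      exact ⟨i.1, i.2⟩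
    · rintro _ ⟨v, rfl⟩ _ ⟨w, rfl⟩ h1 - huniq
      have hval : ((Γ.black ⊔ Γ.blue ⊔ Γ.red).neighborSet v) = {w} := by
        ext z
        constructor
        · intro hz
          refine hf (huniq _ ⟨z, rfl⟩ ?_)
          rw [hfadj, comap_adj, hRadj]
          exact hz.imp id Or.inr
        · rintro rfl
          exact Or.inl ((hfadj _ _).1 h1)
      rcases (hΓ.valence_one v (by rw [hval, Set.ncard_singleton])).2 with ⟨a, rfl⟩ | ⟨a, rfl⟩
      · left
        rw [hfι]
        exact a.2
      · right
        rw [Set.mem_preimage, hg, hfj]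
        exact a.2
  let e : Γ.vert ≃ blackVerts I J g :=
    (Equiv.ofInjective f hf).trans (Equiv.setCongr hcore.symm)
  refine ⟨⟨g, hsph⟩, e, fun a b => biTreeOf_black_adj.trans ?_, fun a b =>
    biTreeOf_blue_adj.trans ?_, fun a b => biTreeOf_red_adj.trans ?_, fun a => ?_, fun a => ?_⟩
  · change T.Adj (f a) (f b) ∧ T.Adj (g (f a)) (g (f b)) ↔ _
    rw [hfadj, hRadj]
    exact ⟨fun ⟨h1, h2⟩ => h1.elim id fun h => absurd h2 (hblue _ _ h),
      fun h => ⟨Or.inl h, Or.inl h⟩⟩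
  · change T.Adj (f a) (f b) ∧ ¬ T.Adj (g (f a)) (g (f b)) ↔ _
    rw [hfadj, hRadj]
    exact ⟨fun ⟨h1, h2⟩ => h1.elim (fun h => absurd (Or.inl h) h2) id,
      fun h => ⟨Or.inr h, hblue _ _ h⟩⟩
  · change T.Adj (g (f a)) (g (f b)) ∧ ¬ T.Adj (f a) (f b) ↔ _
    rw [hfadj, hRadj]
    exact ⟨fun ⟨h1, h2⟩ => h1.elim (fun h => absurd (Or.inl h) h2) id,
      fun h => ⟨Or.inr h, hred _ _ h⟩⟩
  · exact Subtype.ext (hfι a).symm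
  · refine Subtype.ext ?_
    change g⁻¹ a.1 = f (Γ.j a)
    rw [Equiv.Perm.inv_eq_iff_eq, hg, hfj]

/-- A function on a group whose fibres are the double cosets of `H` and `K` descends to a bijection
from the double coset space. -/
theorem exists_doubleCoset_equiv {G C : Type*} [Group G] (H K : Subgroup G) (c : G → C)
    (hc : ∀ a b, c a = c b ↔ ∃ h ∈ H, ∃ k ∈ K, b = h * a * k) (hsurj : Function.Surjective c) :
    ∃ Φ : DoubleCoset.Quotient (H : Set G) (K : Set G) ≃ C,
      ∀ g, Φ (DoubleCoset.mk H K g) = c g := by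
  let F : DoubleCoset.Quotient (H : Set G) (K : Set G) → C :=
    Quotient.lift c fun a b hab => (hc a b).2 (DoubleCoset.rel_iff.1 hab)
  refine ⟨Equiv.ofBijective F ⟨?_, fun x => ?_⟩, fun g => rfl⟩
  · intro x y
    induction x using Quotient.inductionOn with | _ a => ?_
    induction y using Quotient.inductionOn with | _ b => ?_
    exact fun h => Quotient.sound (DoubleCoset.rel_iff.2 ((hc a b).1 h))
  · obtain ⟨a, rfl⟩ := hsurj x
    exact ⟨DoubleCoset.mk H K a, rfl⟩

end Main

end Sphero

theorem proposition4p1 {V : Type u} (T : SimpleGraph V) (hT : Sphero.IsCountableValenceTree T)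
    (I J : T.Subgraph) (hI : I.coe.IsTree) (hIfin : I.verts.Finite)
    (hJ : J.coe.IsTree) (hJfin : J.verts.Finite) :
    ∃ h : ∀ g : Sphero.Hier T, (Sphero.biTreeOf I J g.1).IsBiTree,
      (∃ Φ : DoubleCoset.Quotient (Sphero.stab J : Set (Sphero.Hier T))
          (Sphero.stab I : Set (Sphero.Hier T)) ≃ Sphero.BiTreeClass I J,
        ∀ g : Sphero.Hier T,
          Φ (DoubleCoset.mk (Sphero.stab J) (Sphero.stab I) g) =
            Quotient.mk (Sphero.biTreeSetoid I J) ⟨Sphero.biTreeOf I J g.1, h g⟩) ∧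
      (∃ Ψ : DoubleCoset.Quotient (Sphero.stab I : Set (Sphero.Hier T))
          (Sphero.stab J : Set (Sphero.Hier T)) ≃ Sphero.BiTreeClass I J,
        ∀ g : Sphero.Hier T,
          Ψ (DoubleCoset.mk (Sphero.stab I) (Sphero.stab J) g) =
            Quotient.mk (Sphero.biTreeSetoid I J) ⟨Sphero.biTreeOf I J (g⁻¹).1, h g⁻¹⟩) := by
  have hIne : I.verts.Nonempty := Set.nonempty_coe_sort.1 hI.connected.nonempty
  have hJne : J.verts.Nonempty := Set.nonempty_coe_sort.1 hJ.connected.nonempty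
  have h : ∀ g : Sphero.Hier T, (Sphero.biTreeOf I J g.1).IsBiTree := fun g =>
    Sphero.isBiTree_biTreeOf hT.isTree hIne hIfin hJne hJfin g.2
  let c : Sphero.Hier T → Sphero.BiTreeClass I J := fun g =>
    Quotient.mk (Sphero.biTreeSetoid I J) ⟨Sphero.biTreeOf I J g.1, h g⟩
  have hc : ∀ a b, c a = c b ↔ ∃ l ∈ Sphero.stab J, ∃ k ∈ Sphero.stab I, b = l * a * k := by
    intro a b
    constructor
    · exact fun hab => Sphero.exists_mul_eq_of_equivalent hT (h a) (h b) (Quotient.exact hab)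
    · rintro ⟨l, hl, k, hk, rfl⟩
      exact (Quotient.sound (Sphero.equivalent_biTreeOf_mul hT.isTree hl hk a)).symm
  have hsurj : Function.Surjective c := by
    intro x
    induction x using Quotient.inductionOn with | _ Γ => ?_
    obtain ⟨g, hg⟩ := Sphero.exists_biTreeOf_equivalent hT hI hIfin hJ hJfin Γ.1 Γ.2
    exact ⟨g, (Quotient.sound hg).symm⟩
  refine ⟨h, Sphero.exists_doubleCoset_equiv _ _ c hc hsurj,
    -- Inversion exchanges the two kinds of double cosets.
    Sphero.exists_doubleCoset_equiv _ _ (fun g => c g⁻¹) (fun a b => ?_)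
      (hsurj.comp inv_surjective)⟩
  rw [hc]
  constructor
  · rintro ⟨l, hl, k, hk, hab⟩
    exact ⟨k⁻¹, inv_mem hk, l⁻¹, inv_mem hl, by rw [← inv_inj, hab]; group⟩
  · rintro ⟨k, hk, l, hl, rfl⟩
    exact ⟨l⁻¹, inv_mem hl, k⁻¹, inv_mem hk, by group⟩
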